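/- Digraphs are finite. A homomorphism of digraphs is an arc-preserving map of the vertex sets; two digraphs are hom-equivalent if each admits a homomorphism to the other. A core of a digraph $G$ is a digraph with the smallest number of vertices among all digraphs hom-equivalent to $G$, and $G$ is a core if it is a core of itself. The tensor product $\prod_i G_i$ has vertex set $\prod_i V(G_i)$, with an arc $u\to v$ iff $u_i\to v_i$ is an arc of $G_i$ for every $i$. The cone ${}^{\triangleleft}G$ is obtained from a digraph $G$ by adding one new vertex linked in both directions with every vertex of $G$. For $h\ge 3$ and a sequence $\partial=(\partial_1,\dots,\partial_\ell)$ with $h-2\ge\partial_1>\partial_2>\dots>\partial_\ell\ge 1$, the decreasing mountain $M_\partial$ of height $h$ is the oriented path whose arcs, from beginning to end, are: one forward arc; then, for $i=1,\dots,\ell$ in turn, $\partial_i$ forward arcs followed by $\partial_i$ backward arcs; then $h-2$ forward arcs; then one last forward arc. Let $DM_{h,\ell}$ be the set of all decreasing mountains of height $h$ with $\ell$ peaks, and let $DM^{\max}_{h,\ell}\subseteq DM_{h,\ell}$ consist of those with $\ell\geq 1$ and $\partial_1=h-2$. **Theorem.** 1. For all integers $\ell\ge 0$ and $h>\ell+2$,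 the digraph $\prod_{M_\partial\in DM_{h,\ell}}{}^{\triangleleft}M_\partial$ is a core. Moreover there are exactly $\binom{h-2}{\ell}$ sequences $\partial$ as above, and distinct sequences give non-isomorphic mountains, so $|DM_{h,\ell}|=\binom{h-2}{\ell}$. 2. For every $k\ge 1$, every core of $\prod_{M_\partial\in DM_{2k+2,k}}{}^{\triangleleft}M_\partial$ has at least $(k^2+5k+2)^{\binom{2k}{k}}$ vertices. 3. For all integers $\ell\ge 1$ and $h>\ell+2$, the digraph $\prod_{M_\partial\in DM^{\max}_{h,\ell}}{}^{\triangleleft}M_\partial$ is a core, and $|DM^{\max}_{h,\ell}|=\binom{h-3}{\ell-1}$. 4. For every $k\ge 1$, every core of $\prod_{M_\partial\in DM^{\max}_{2k+2,k}}{}^{\triangleleft}M_\partial$ has at least $(k^2+5k+2)^{\binom{2k-1}{k-1}}$ vertices. -/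

import Mathlib

/-! Digraphs are Mathlib's `Digraph V`; a homomorphism from `G` to `H` is a relation homomorphism
`G.Adj →r H.Adj`, an isomorphism is a relation isomorphism `G.Adj ≃r H.Adj`. -/

/-- `G` and `H` are homomorphically equivalent: each admits a homomorphism to the other. -/
def HomEquiv {V W : Type} (G : Digraph V) (H : Digraph W) : Prop :=
  Nonempty (G.Adj →r H.Adj) ∧ Nonempty (H.Adj →r G.Adj)

/-- `C` is a core of `G`: a finite digraph that is homomorphically equivalent to `G` and has the
smallest number of vertices among all such finite digraphs. -/
def IsCoreOf {W V : Type} (C : Digraph W) (G : Digraph V) : Prop :=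
  Finite W ∧ HomEquiv C G ∧
    ∀ (X : Type) [Finite X] (H : Digraph X), HomEquiv H G → Nat.card W ≤ Nat.card X

/-- `G` is a core: it is a core of itself. -/
def IsCore {V : Type} (G : Digraph V) : Prop :=
  IsCoreOf G G

/-- The tensor (categorical) product of a family of digraphs: there is an arc from `u` to `v` when
there is an arc from `u i` to `v i` in every factor. -/
def tensorProduct {ι : Type} {V : ι → Type} (G : ∀ i, Digraph (V i)) : Digraph (∀ i, V i) where
  Adj u v := ∀ i, (G i).Adj (u i) (v i)

/-- The cone over `G`: a new vertex `none` (the apex) is linked in both directions with every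
vertex of `G`; there is no loop at the apex. -/
def cone {V : Type} (G : Digraph V) : Digraph (Option V) where
  Adj
    | some u, some v => G.Adj u v
    | some _, none => True
    | none, some _ => True
    | none, none => False

/-- The letters of the word of an oriented path: a forward arc or a backward arc. -/
inductive Letter where
  | up
  | down

/-- The oriented path `0, 1, …, n` whose successive arcs are given by a word of length `n`: the
`i`-th arc is `i ⟶ i + 1` if the letter is `up`, and `i + 1 ⟶ i` if it is `down`. -/
def orientedPath (w : List Letter) : Digraph (Fin (w.length + 1)) where
  Adj u v :=
    (v.val = u.val + 1 ∧ w[u.val]? = some Letter.up) ∨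
      (u.val = v.val + 1 ∧ w[v.val]? = some Letter.down)

/-- The word of the mountain of height `k + 2` with sequence of peaks `l`: every peak `a` of `l`
contributes `a` letters `up` followed by `a` letters `down`, and the word ends with `k` letters
`up`. The first and the last arc of the path are not recorded in this word. -/
def mountainWord (k : ℕ) (l : List ℕ) : List Letter :=
  l.flatMap (fun a => List.replicate a Letter.up ++ List.replicate a Letter.down) ++
    List.replicate k Letter.up

/-- All the arcs of the mountain of height `h` (for `2 ≤ h`) with sequence of peaks `l`: a forward
first arc, the word of the mountain, and a forward last arc. -/
def mountainArcs (h : ℕ) (l : List ℕ) : List Letter :=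
  Letter.up :: (mountainWord (h - 2) l ++ [Letter.up])

/-- The mountain of height `h` (for `2 ≤ h`) with sequence of peaks `l`. -/
def mountain (h : ℕ) (l : List ℕ) : Digraph (Fin ((mountainArcs h l).length + 1)) :=
  orientedPath (mountainArcs h l)

/-- The sequences of the decreasing mountains of height `h` with `ℓ` peaks: the strictly decreasing
sequences of length `ℓ` with entries in `{1, …, h - 2}`. -/
def DM (h ℓ : ℕ) : Set (List ℕ) :=
  {l | l.length = ℓ ∧ l.Pairwise (· > ·) ∧ ∀ a ∈ l, 1 ≤ a ∧ a ≤ h - 2}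

/-- The sequences in `DM h ℓ` whose first entry takes the maximal value `h - 2`. -/
def DMtop (h ℓ : ℕ) : Set (List ℕ) :=
  {l ∈ DM h ℓ | l.head? = some (h - 2)}

/-- The tensor product of the cones over the mountains of height `h` with sequence in `S`. -/
def coneProduct (h : ℕ) (S : Set (List ℕ)) :
    Digraph (∀ d : S, Option (Fin ((mountainArcs h d.val).length + 1))) :=
  tensorProduct fun d : S => cone (mountain h d.val)

/-! Every homomorphism `f` from the product of cones to the cone over one factor mountain `M_j` is
the `j`-th projection (`hom_eq_proj`). So every endomorphism of the product is the identity, which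
makes it a core; the bounds on cores then follow by counting its vertices.

To each vertex attach the set of coordinates where it is the apex. Since mountains have no 2-cycles,
whether `f` sends a vertex to the apex depends only on this set. The sets that are sent to the apex
intersect pairwise, and of two complementary sets exactly one belongs to the family. If some member
has at most one element, the family consists of all sets containing one coordinate `i`
(`preimage_apex_cases`). Otherwise vertices with at most one apex coordinate all map into the
mountain, and long directed walks there give a contradiction (`not_hom_of_apex_not_mem`).

In the remaining case `f` restricts to homomorphisms `M_i → M_j`. Heights and the number of peaks
passed are preserved, which forces `M_i = M_j` and the identity map (`eq_of_hom_mountain`). Hence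
`f` is the projection. -/

/-! ### Heights and peak counts along the word of a mountain. -/

/-- The height, above the valleys, of the `x`-th vertex of the path with word `mountainWord k l`. -/
def relHeight : List ℕ → ℕ → ℕ
  | [], x => x
  | a :: l, x => if x < 2 * a then min x (2 * a - x) else relHeight l (x - 2 * a)

/-- The number of peaks of `mountainWord k l` that lie entirely before the `x`-th vertex. -/
def relIndex : List ℕ → ℕ → ℕ
  | [], _ => 0
  | a :: l, x => if x < 2 * a then 0 else relIndex l (x - 2 * a) + 1

theorem relHeight_cons_of_lt {a x : ℕ} (l : List ℕ) (h : x < 2 * a) :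
    relHeight (a :: l) x = min x (2 * a - x) := if_pos h

theorem relHeight_cons_of_le {a x : ℕ} (l : List ℕ) (h : 2 * a ≤ x) :
    relHeight (a :: l) x = relHeight l (x - 2 * a) := if_neg (by omega)

theorem relIndex_cons_of_lt {a x : ℕ} (l : List ℕ) (h : x < 2 * a) :
    relIndex (a :: l) x = 0 := if_pos h

theorem relIndex_cons_of_le {a x : ℕ} (l : List ℕ) (h : 2 * a ≤ x) :
    relIndex (a :: l) x = relIndex l (x - 2 * a) + 1 := if_neg (by omega)

theorem relHeight_zero (l : List ℕ) : relHeight l 0 = 0 := by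
  induction l with
  | nil => rfl
  | cons a l ih => simp [relHeight, ih]

theorem relIndex_zero (l : List ℕ) (hl : ∀ a ∈ l, 1 ≤ a) : relIndex l 0 = 0 := by
  cases l with
  | nil => rfl
  | cons a l =>
    have := hl a (by simp)
    simp [relIndex]; omega

theorem mountainWord_cons (k a : ℕ) (l : List ℕ) :
    mountainWord k (a :: l) =
      List.replicate a Letter.up ++ (List.replicate a Letter.down ++ mountainWord k l) := by
  simp [mountainWord]

theorem length_mountainWord (k : ℕ) (l : List ℕ) :
    (mountainWord k l).length = 2 * l.sum + k := by
  induction l with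
  | nil => simp [mountainWord]
  | cons a l ih => rw [mountainWord_cons]; simp [ih]; ring

theorem relHeight_succ_of_up (k : ℕ) (l : List ℕ) (x : ℕ)
    (hx : (mountainWord k l)[x]? = some Letter.up) :
    relHeight l (x + 1) = relHeight l x + 1 := by
  induction l generalizing x with
  | nil => rfl
  | cons a l ih =>
    rw [mountainWord_cons, List.getElem?_append, List.getElem?_append] at hx
    simp only [List.length_replicate, List.getElem?_replicate] at hx
    split_ifs at hx with h1 h2
    · simp only [relHeight]
      rcases Nat.lt_or_ge (x + 1) (2 * a) with h | h
      · rw [if_pos h, if_pos (by omega)]; omega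
      · rw [if_neg (by omega), if_pos (by omega), show x + 1 - 2 * a = 0 by omega, relHeight_zero]
        omega
    · simp at hx
    · have := ih _ hx
      simp only [relHeight]
      rw [if_neg (by omega), if_neg (by omega), ← show x - a - a + 1 = x + 1 - 2 * a by omega, this]
      congr 2; omega

theorem relHeight_of_down (k : ℕ) (l : List ℕ) (x : ℕ)
    (hx : (mountainWord k l)[x]? = some Letter.down) :
    relHeight l x = relHeight l (x + 1) + 1 := by
  induction l generalizing x with
  | nil => simp [mountainWord, List.getElem?_replicate] at hx
  | cons a l ih =>
    rw [mountainWord_cons, List.getElem?_append, List.getElem?_append] at hx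
    simp only [List.length_replicate, List.getElem?_replicate] at hx
    split_ifs at hx with h1 h2
    · simp at hx
    · rw [relHeight_cons_of_lt l (by omega)]
      rcases Nat.lt_or_ge (x + 1) (2 * a) with h | h
      · rw [relHeight_cons_of_lt l h]; omega
      · rw [relHeight_cons_of_le l h, show x + 1 - 2 * a = 0 by omega, relHeight_zero]
        omega
    · have := ih _ hx
      simp only [relHeight]
      rw [if_neg (by omega), if_neg (by omega), ← show x - a - a + 1 = x + 1 - 2 * a by omega,
        ← this]
      congr 1; omega

theorem relHeight_le (k : ℕ) (l : List ℕ) (hl : ∀ a ∈ l, a < k) (x : ℕ)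
    (hx : x ≤ 2 * l.sum + k) :
    relHeight l x ≤ k ∧ (relHeight l x = k → x = 2 * l.sum + k) := by
  induction l generalizing x with
  | nil => simpa [relHeight] using hx
  | cons a l ih =>
    have ha := hl a (by simp)
    simp only [List.sum_cons] at hx ⊢
    simp only [relHeight]
    split_ifs with h
    · omega
    · have := ih (fun b hb => hl b (by simp [hb])) (x - 2 * a) (by omega)
      omega

theorem relIndex_succ (l : List ℕ) (hl : ∀ a ∈ l, 1 ≤ a) (x : ℕ) :
    relIndex l (x + 1) = relIndex l x + if relHeight l (x + 1) = 0 then 1 else 0 := by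
  induction l generalizing x with
  | nil => simp [relIndex, relHeight]
  | cons a l ih =>
    have hl' : ∀ b ∈ l, 1 ≤ b := fun b hb => hl b (by simp [hb])
    rcases Nat.lt_trichotomy (x + 1) (2 * a) with h | h | h
    · rw [relIndex_cons_of_lt l h, relIndex_cons_of_lt l (by omega), relHeight_cons_of_lt l h,
        if_neg (by omega)]
    · rw [relIndex_cons_of_le l h.ge, relIndex_cons_of_lt l (by omega),
        relHeight_cons_of_le l h.ge, h, Nat.sub_self, relHeight_zero, relIndex_zero l hl']
      simp
    · rw [relIndex_cons_of_le l (by omega), relIndex_cons_of_le l (by omega),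
        relHeight_cons_of_le l (by omega), show x + 1 - 2 * a = x - 2 * a + 1 by omega, ih hl']
      omega

theorem relIndex_end (k : ℕ) (l : List ℕ) : relIndex l (2 * l.sum + k) = l.length := by
  induction l with
  | nil => rfl
  | cons a l ih =>
    rw [List.sum_cons, List.length_cons, relIndex_cons_of_le l (by omega), show 2 * (a + l.sum) + k - 2 * a = 2 * l.sum + k by omega, ih]

theorem relHeight_le_of_relIndex (l : List ℕ) (x : ℕ) (hx : relIndex l x < l.length) :
    relHeight l x ≤ l[relIndex l x] := by
  induction l generalizing x with
  | nil => simp at hx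
  | cons a l ih =>
    by_cases h : x < 2 * a
    · simp only [relHeight, relIndex, if_pos h, List.getElem_cons_zero]; omega
    · simp only [relHeight, relIndex, if_neg h, List.getElem_cons_succ]
      simp only [relIndex, if_neg h, List.length_cons] at hx
      exact ih _ (by omega)

theorem exists_peak (l : List ℕ) (hl : ∀ a ∈ l, 1 ≤ a) (i : ℕ) (hi : i < l.length) :
    ∃ x ≤ 2 * l.sum, relIndex l x = i ∧ relHeight l x = l[i] := by
  induction l generalizing i with
  | nil => simp at hi
  | cons a l ih =>
    have ha := hl a (by simp)
    cases i with
    | zero =>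
      refine ⟨a, by simp only [List.sum_cons]; omega, ?_, ?_⟩
      · simp only [relIndex]; rw [if_pos (by omega)]
      · simp only [relHeight, List.getElem_cons_zero]; rw [if_pos (by omega)]; omega
    | succ i =>
      obtain ⟨x, hx, h1, h2⟩ := ih (fun b hb => hl b (by simp [hb])) i (by simpa using hi)
      refine ⟨x + 2 * a, by simp only [List.sum_cons]; omega, ?_, ?_⟩
      · simp only [relIndex]; rw [if_neg (by omega), Nat.add_sub_cancel, h1]
      · simp only [relHeight, List.getElem_cons_succ]
        rw [if_neg (by omega), Nat.add_sub_cancel, h2]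

/-! ### Heights and peak counts along a mountain. -/

/-- The height of the `x`-th vertex of a mountain with sequence of peaks `l`. -/
def height (l : List ℕ) : ℕ → ℕ
  | 0 => 0
  | x + 1 => relHeight l x + 1

/-- The number of peaks of a mountain that lie entirely before the `x`-th vertex. -/
def valleyIndex (l : List ℕ) : ℕ → ℕ
  | 0 => 0
  | x + 1 => relIndex l x

/-- The last arc is absorbed into the final climb, so the results on words apply with `h - 1` in
place of `h - 2`. -/
theorem mountainArcs_eq (h : ℕ) (l : List ℕ) (hh : 2 ≤ h) :
    mountainArcs h l = Letter.up :: mountainWord (h - 1) l := by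
  obtain ⟨k, rfl⟩ := Nat.exists_eq_add_of_le' hh
  simp [mountainArcs, mountainWord, List.replicate_succ']

theorem length_mountainArcs (h : ℕ) (l : List ℕ) (hh : 2 ≤ h) :
    (mountainArcs h l).length = 2 * l.sum + h := by
  rw [mountainArcs_eq h l hh, List.length_cons, length_mountainWord]; omega

theorem mountain_adj {h : ℕ} (hh : 2 ≤ h) {l : List ℕ}
    {u v : Fin ((mountainArcs h l).length + 1)} (huv : (mountain h l).Adj u v) :
    height l v = height l u + 1 ∧ (v.val = u.val + 1 ∨ u.val = v.val + 1) := by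
  obtain ⟨u, hu⟩ := u
  obtain ⟨v, hv⟩ := v
  simp only [mountain, orientedPath] at huv
  rw [mountainArcs_eq h l hh] at huv
  rcases huv with ⟨rfl, h2⟩ | ⟨rfl, h2⟩
  · refine ⟨?_, .inl rfl⟩
    cases u with
    | zero => simp [height, relHeight_zero]
    | succ x =>
      simp only [height]
      rw [relHeight_succ_of_up (h - 1) l x (by simpa using h2)]
  · refine ⟨?_, .inr rfl⟩
    cases v with
    | zero => simp at h2
    | succ x =>
      simp only [height]
      rw [relHeight_of_down (h - 1) l x (by simpa using h2)]

/-- A peak `a` has its summit at height `a + 1 ≤ h - 1`, so only the end of the final climb reaches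
`h`. -/
theorem height_le {h : ℕ} (hh : 2 ≤ h) {l : List ℕ} (hl : ∀ a ∈ l, a ≤ h - 2)
    (u : Fin ((mountainArcs h l).length + 1)) :
    height l u ≤ h ∧ (height l u = h → u = Fin.last _) := by
  obtain ⟨u, hu⟩ := u
  have hn := length_mountainArcs h l hh
  cases u with
  | zero => simp [height]; omega
  | succ x =>
    have := relHeight_le (h - 1) l (fun a ha => by have := hl a ha; omega) x (by omega)
    simp only [height, Fin.ext_iff, Fin.val_last]
    omega

theorem eq_zero_of_height {l : List ℕ} {x : ℕ} (hx : height l x = 0) : x = 0 := by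
  cases x with
  | zero => rfl
  | succ x => simp [height] at hx

theorem height_last {h : ℕ} (hh : 2 ≤ h) (l : List ℕ) :
    height l (mountainArcs h l).length = h := by
  rw [length_mountainArcs h l hh]
  obtain ⟨k, rfl⟩ := Nat.exists_eq_add_of_le' hh
  have key : ∀ (l : List ℕ) (m : ℕ), relHeight l (2 * l.sum + m) = m := by
    intro l m
    induction l with
    | nil => simp [relHeight]
    | cons a l ih =>
      rw [List.sum_cons, relHeight_cons_of_le l (by omega), show 2 * (a + l.sum) + m - 2 * a = 2 * l.sum + m by omega, ih]
  change relHeight l (2 * l.sum + (k + 1)) + 1 = k + 2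
  rw [key]

theorem valleyIndex_last {h : ℕ} (hh : 2 ≤ h) (l : List ℕ) :
    valleyIndex l (mountainArcs h l).length = l.length := by
  rw [length_mountainArcs h l hh]
  obtain ⟨k, rfl⟩ := Nat.exists_eq_add_of_le' hh
  exact relIndex_end (k + 1) l

/-- A peak is completed exactly on return to height 1; `x ≠ 0` excludes the arrival by the first
arc. -/
theorem valleyIndex_succ (l : List ℕ) (hl : ∀ a ∈ l, 1 ≤ a) (x : ℕ) :
    valleyIndex l (x + 1) = valleyIndex l x + if height l (x + 1) = 1 ∧ x ≠ 0 then 1 else 0 := by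
  cases x with
  | zero => simp [valleyIndex, relIndex_zero l hl]
  | succ x => simp [valleyIndex, height, relIndex_succ l hl x]

theorem valleyIndex_le_of_adj {h : ℕ} (hh : 2 ≤ h) {l : List ℕ} (hl : ∀ a ∈ l, 1 ≤ a)
    {u v : Fin ((mountainArcs h l).length + 1)}
    (huv : (mountain h l).Adj u v ∨ (mountain h l).Adj v u) :
    valleyIndex l v ≤ valleyIndex l u + if height l v = 1 ∧ u.val ≠ 0 then 1 else 0 := by
  have : v.val = u.val + 1 ∨ u.val = v.val + 1 := by
    rcases huv with h | h
    · exact (mountain_adj hh h).2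
    · exact (mountain_adj hh h).2.symm
  rcases this with h | h
  · rw [h, valleyIndex_succ l hl]
  · rw [h, valleyIndex_succ l hl]; omega

theorem height_le_of_valleyIndex {l : List ℕ} {x : ℕ} (hx : valleyIndex l x < l.length) :
    height l x ≤ l[valleyIndex l x] + 1 := by
  cases x with
  | zero => simp [height]
  | succ x => exact Nat.succ_le_succ (relHeight_le_of_relIndex l x hx)

theorem mountain_adj_or {h : ℕ} {l : List ℕ} (u v : Fin ((mountainArcs h l).length + 1))
    (huv : v.val = u.val + 1) : (mountain h l).Adj u v ∨ (mountain h l).Adj v u := by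
  have hu : u.val < (mountainArcs h l).length := by omega
  simp only [mountain, orientedPath, List.getElem?_eq_getElem hu, huv]
  cases (mountainArcs h l)[u.val] <;> simp

theorem mountain_adj_zero_one {h : ℕ} {l : List ℕ} (u v : Fin ((mountainArcs h l).length + 1))
    (hu : u.val = 0) (hv : v.val = 1) : (mountain h l).Adj u v := by
  simp [mountain, orientedPath, hu, hv, mountainArcs]

theorem mountain_adj_last_climb {h : ℕ} (hh : 2 ≤ h) {l : List ℕ}
    (u v : Fin ((mountainArcs h l).length + 1)) (huv : v.val = u.val + 1)
    (hu : 2 * l.sum + 1 ≤ u.val) : (mountain h l).Adj u v := by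
  refine .inl ⟨huv, ?_⟩
  have hn := length_mountainArcs h l hh
  have key : ∀ (l : List ℕ) (k m : ℕ), m < k →
      (mountainWord k l)[2 * l.sum + m]? = some Letter.up := by
    intro l k m hm
    induction l with
    | nil => simp [mountainWord, hm]
    | cons a l ih =>
      rw [mountainWord_cons, List.sum_cons, List.getElem?_append_right (by simp; omega),
        List.getElem?_append_right (by simp; omega), ← ih]
      congr 1
      simp; omega
  obtain ⟨m, hm⟩ := Nat.exists_eq_add_of_le hu
  generalize u.val = x at hm hu huv
  rw [mountainArcs_eq h l hh, show x = 2 * l.sum + m + 1 by omega, List.getElem?_cons_succ]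
  exact key l (h - 1) m (by omega)

theorem List.eq_of_getElem_le_of_sum_le {l m : List ℕ} (hlen : l.length = m.length)
    (hle : ∀ (i : ℕ) (h₁ : i < l.length) (h₂ : i < m.length), l[i] ≤ m[i])
    (hsum : m.sum ≤ l.sum) : l = m := by
  have key : ∀ {l m : List ℕ}, List.Forall₂ (· ≤ ·) l m →
      l.sum ≤ m.sum ∧ (m.sum ≤ l.sum → l = m) := by
    intro l m h
    induction h with
    | nil => simp
    | cons h _ ih =>
      simp only [List.sum_cons, List.cons.injEq]
      refine ⟨by omega, fun h' => ?_⟩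
      exact ⟨by omega, ih.2 (by omega)⟩
  exact (key (List.forall₂_iff_get.2 ⟨hlen, fun i h₁ h₂ => hle i h₁ h₂⟩)).2 hsum

/-! ### Rigidity of homomorphisms between mountains. -/

section Rigidity

variable {h : ℕ} {d e : List ℕ}

/-- A homomorphism shifts heights by a constant; the last vertex already has the maximal height `h`,
so the shift is 0. -/
theorem height_hom (hh : 2 ≤ h) (he : ∀ a ∈ e, a ≤ h - 2)
    (f : (mountain h d).Adj →r (mountain h e).Adj) (x : Fin ((mountainArcs h d).length + 1)) :
    height e (f x) = height d x := by
  have step : ∀ x : Fin ((mountainArcs h d).length + 1),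
      height e (f x) = height d x + height e (f 0) := by
    intro x
    induction x using Fin.induction with
    | zero => simp [height]
    | succ x ih =>
      rcases mountain_adj_or x.castSucc x.succ (by simp) with hx | hx
      · have h1 := (mountain_adj hh hx).1
        have h2 := (mountain_adj hh (f.map_rel hx)).1
        omega
      · have h1 := (mountain_adj hh hx).1
        have h2 := (mountain_adj hh (f.map_rel hx)).1
        omega
  have h1 := step (Fin.last _)
  rw [Fin.val_last, height_last hh] at h1
  have h2 := (height_le hh he (f (Fin.last _))).1
  rw [step x]
  omega

theorem valleyIndex_hom (hh : 2 ≤ h) (hlen : d.length = e.length)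
    (hd : ∀ a ∈ d, 1 ≤ a) (he : ∀ a ∈ e, 1 ≤ a ∧ a ≤ h - 2)
    (f : (mountain h d).Adj →r (mountain h e).Adj) (x : Fin ((mountainArcs h d).length + 1)) :
    valleyIndex e (f x) = valleyIndex d x := by
  have hlev := height_hom hh (fun a ha => (he a ha).2) f
  have hzero : f 0 = 0 := Fin.ext (eq_zero_of_height (by rw [hlev]; rfl))
  have hlast : f (Fin.last _) = Fin.last _ := by
    refine (height_le hh (fun a ha => (he a ha).2) _).2 ?_
    rw [hlev, Fin.val_last, height_last hh]
  -- The image path reaches height 1 only when the original path does, so it can complete a peak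
  -- only at those moments. The count for the image minus the count for the original is thus
  -- nonincreasing; it vanishes at both ends, hence everywhere.
  have step : ∀ x : Fin (mountainArcs h d).length,
      valleyIndex e (f x.succ) + valleyIndex d x.castSucc ≤
        valleyIndex e (f x.castSucc) + valleyIndex d x.succ := by
    intro x
    have hadj := (mountain_adj_or x.castSucc x.succ (by simp)).imp f.map_rel f.map_rel
    have h1 := valleyIndex_le_of_adj hh (fun a ha => (he a ha).1) hadj
    have h2 := valleyIndex_succ d hd x.val
    rw [hlev] at h1
    simp only [Fin.val_succ, Fin.val_castSucc] at h1 h2 ⊢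
    by_cases hx : x.val = 0
    · have hx' : x.castSucc = 0 := Fin.ext hx
      rw [hx', hzero] at h1 ⊢
      simp [hx] at h1 h2 ⊢
      omega
    · rw [h2]
      have h3 : (if height d (x.val + 1) = 1 ∧ (f x.castSucc).val ≠ 0 then 1 else 0) ≤
          (if height d (x.val + 1) = 1 ∧ x.val ≠ 0 then 1 else 0) := by
        split_ifs <;> simp_all
      omega
  have hle : ∀ x : Fin ((mountainArcs h d).length + 1),
      valleyIndex e (f x) ≤ valleyIndex d x := by
    intro x
    induction x using Fin.induction with
    | zero => rw [hzero]; simp [valleyIndex]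
    | succ x ih => have := step x; omega
  have hge : ∀ x : Fin ((mountainArcs h d).length + 1),
      valleyIndex d x ≤ valleyIndex e (f x) := by
    intro x
    induction x using Fin.reverseInduction with
    | last => rw [hlast, Fin.val_last, Fin.val_last, valleyIndex_last hh, valleyIndex_last hh, hlen]
    | cast x ih => have := step x; omega
  exact le_antisymm (hle x) (hge x)

/-- The summit of the `i`-th peak of `d` lands at the same height within the `i`-th peak of `e`, so
`d ≤ e` entrywise. The image path joins the two ends of the target by steps of length one, so the
target is no longer than the source. Hence `d = e`, and there is no slack left for `f` to move a
vertex. -/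
theorem eq_of_hom_mountain (hh : 2 ≤ h) (hlen : d.length = e.length)
    (hd : ∀ a ∈ d, 1 ≤ a) (he : ∀ a ∈ e, 1 ≤ a ∧ a ≤ h - 2)
    (f : (mountain h d).Adj →r (mountain h e).Adj) :
    d = e ∧ ∀ x, (f x).val = x.val := by
  have hlev := height_hom hh (fun a ha => (he a ha).2) f
  have hidx := valleyIndex_hom hh hlen hd he f
  have hzero : (f 0).val = 0 := eq_zero_of_height (by rw [hlev]; rfl)
  have hlast : f (Fin.last _) = Fin.last _ := by
    refine (height_le hh (fun a ha => (he a ha).2) _).2 ?_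
    rw [hlev, Fin.val_last, height_last hh]
  have hnd := length_mountainArcs h d hh
  have hne := length_mountainArcs h e hh
  have step : ∀ x : Fin (mountainArcs h d).length, (f x.succ).val ≤ (f x.castSucc).val + 1 := by
    intro x
    rcases mountain_adj_or x.castSucc x.succ (by simp) with hx | hx
    · have := (mountain_adj hh (f.map_rel hx)).2; omega
    · have := (mountain_adj hh (f.map_rel hx)).2; omega
  have hle : ∀ x : Fin ((mountainArcs h d).length + 1), (f x).val ≤ x.val := by
    intro x
    induction x using Fin.induction with
    | zero => simp [hzero]
    | succ x ih => have := step x; simp at ih ⊢; omega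
  have hge : ∀ x : Fin ((mountainArcs h d).length + 1),
      (mountainArcs h e).length + x.val ≤ (f x).val + (mountainArcs h d).length := by
    intro x
    induction x using Fin.reverseInduction with
    | last => simp [hlast]
    | cast x ih => have := step x; simp at ih ⊢; omega
  have hde : d = e := by
    refine List.eq_of_getElem_le_of_sum_le hlen (fun i h₁ h₂ => ?_) ?_
    · obtain ⟨x, hx, hi, hp⟩ := exists_peak d hd i h₁
      have h1 : valleyIndex e (f ⟨x + 1, by omega⟩) = i := (hidx _).trans hi
      have h2 : height e (f ⟨x + 1, by omega⟩) = d[i] + 1 := (hlev _).trans (by simp [height, hp])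
      have h3 := height_le_of_valleyIndex (l := e) (x := f ⟨x + 1, by omega⟩) (by omega)
      simp only [h1] at h3
      omega
    · have := hle (Fin.last _)
      rw [hlast, Fin.val_last, Fin.val_last] at this
      omega
  refine ⟨hde, fun x => ?_⟩
  have h1 := hle x
  have h2 := hge x
  have h3 := congrArg List.sum hde
  omega

end Rigidity

/-! ### Long directed walks in a mountain. -/

/-- A directed walk with `h - 1` arcs in a mountain of height `h ≥ 4` with at least one peak ends
in a vertex without out-neighbours that is the only out-neighbour of its in-neighbours. -/
theorem directed_walk_end {h : ℕ} (hh : 4 ≤ h) {l : List ℕ} (hne : l ≠ [])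
    (hl : ∀ a ∈ l, 1 ≤ a ∧ a ≤ h - 2) (z : ℕ → Fin ((mountainArcs h l).length + 1))
    (hz : ∀ k < h - 1, (mountain h l).Adj (z k) (z (k + 1))) :
    (∀ v, ¬ (mountain h l).Adj (z (h - 1)) v) ∧
      ∀ b v, (mountain h l).Adj b (z (h - 1)) → (mountain h l).Adj b v → v = z (h - 1) := by
  have hh' : 2 ≤ h := by omega
  have hpos : ∀ a ∈ l, 1 ≤ a := fun a ha => (hl a ha).1
  have hle := height_le hh' (fun a ha => (hl a ha).2)
  have hlev : ∀ k ≤ h - 1, height l (z k) = height l (z 0) + k := by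
    intro k hk
    induction k with
    | zero => rfl
    | succ k ih =>
      have := (mountain_adj hh' (hz k (by omega))).1
      have := ih (by omega)
      omega
  have htop := hlev (h - 1) le_rfl
  have h1 := (hle (z (h - 1))).1
  -- A walk from height 0 climbs the first peak, which must have `a = h - 2`, and ends at its
  -- summit. A walk from height 1 ends at height `h`, at the last vertex.
  rcases Nat.eq_zero_or_pos (height l (z 0)) with h0 | h0
  · have hz0 : (z 0).val = 0 := eq_zero_of_height h0
    have hidx : ∀ k ≤ h - 1, valleyIndex l (z k) = 0 := by
      intro k hk
      induction k with
      | zero => simp [hz0, valleyIndex]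
      | succ k ih =>
        have h2 := valleyIndex_le_of_adj hh' hpos (.inl (hz k (by omega)))
        rw [ih (by omega), if_neg] at h2
        · omega
        · rw [hlev (k + 1) hk, h0]
          rintro ⟨h3, h4⟩
          obtain rfl : k = 0 := by omega
          exact h4 hz0
    obtain ⟨a, l', rfl⟩ := List.exists_cons_of_ne_nil hne
    have ha := hl a (by simp)
    have hpeak : ∀ x, valleyIndex (a :: l') x = 0 → height (a :: l') x ≤ a + 1 ∧
        (height (a :: l') x = a + 1 → x = a + 1) := by
      intro x hx
      cases x with
      | zero => simp [height]
      | succ x =>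
        have hx' : x < 2 * a := by
          by_contra hc
          rw [valleyIndex, relIndex_cons_of_le l' (by omega)] at hx
          omega
        rw [height, relHeight_cons_of_lt l' hx']
        omega
    have ht := hpeak _ (hidx (h - 1) le_rfl)
    -- A step to height at least 2 completes no peak. As `h ≥ 4`, this covers in-neighbours of the
    -- summit, at height `h - 2`.
    have hnbr : ∀ u v : Fin ((mountainArcs h (a :: l')).length + 1),
        ((mountain h (a :: l')).Adj u v ∨ (mountain h (a :: l')).Adj v u) →
        valleyIndex (a :: l') u = 0 → 2 ≤ height (a :: l') v → valleyIndex (a :: l') v = 0 := by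
      intro u v huv hu hv
      have := valleyIndex_le_of_adj hh' hpos huv
      rw [hu, if_neg (by omega)] at this
      omega
    refine ⟨fun v hv => ?_, fun b v hb hv => ?_⟩
    · have h2 := (mountain_adj hh' hv).1
      have h3 := hpeak _ (hnbr _ _ (.inl hv) (hidx (h - 1) le_rfl) (by omega))
      omega
    · have h2 := (mountain_adj hh' hb).1
      have h3 := (mountain_adj hh' hv).1
      have h4 := hpeak _ (hnbr _ _ (.inl hv)
        (hnbr _ _ (.inr hb) (hidx (h - 1) le_rfl) (by omega)) (by omega))
      exact Fin.ext (by omega)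
  · have hlast := (hle (z (h - 1))).2 (by omega)
    refine ⟨fun v hv => ?_, fun b v hb hv => ?_⟩
    · have := (mountain_adj hh' hv).1
      have := (hle v).1
      omega
    · rw [hlast]
      refine (hle v).2 ?_
      have := (mountain_adj hh' hb).1
      have := (mountain_adj hh' hv).1
      omega

/-! ### Homomorphisms from a product of cones to a cone. -/

section ConeProduct

variable {ι : Type} {V : ι → Type} {W : Type} {M : ∀ i, Digraph (V i)} {N : Digraph W}
  (f : (tensorProduct fun i => cone (M i)).Adj →r (cone N).Adj)

theorem tensorProduct_cone_adj_of_compl {u v : ∀ i, Option (V i)}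
    (huv : ∀ i, u i = none ↔ v i ≠ none) : (tensorProduct fun i => cone (M i)).Adj u v := by
  intro i
  have := huv i
  cases hu : u i <;> cases hv : v i <;> simp_all [cone]

/-- Vertices with complementary apex sets form a 2-cycle. A 2-cycle in the target passes through the
apex exactly once, as `N` has none and the apex has no loop. -/
theorem map_eq_none_iff_of_compl (hN : ∀ x y, N.Adj x y → ¬ N.Adj y x)
    {u v : ∀ i, Option (V i)} (huv : ∀ i, u i = none ↔ v i ≠ none) :
    f u = none ↔ f v ≠ none := by
  have h1 := f.map_rel (tensorProduct_cone_adj_of_compl (M := M) huv)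
  have h2 := f.map_rel (tensorProduct_cone_adj_of_compl (M := M) (u := v) (v := u)
    fun i => by have := huv i; tauto)
  cases hu : f u <;> cases hv : f v <;> simp_all [cone]

variable [∀ i, Nonempty (V i)]

open Classical in
theorem exists_compl (u : ∀ i, Option (V i)) :
    ∃ v : ∀ i, Option (V i), ∀ i, u i = none ↔ v i ≠ none :=
  ⟨fun i => if u i = none then some (Classical.arbitrary _) else none, fun i => by simp⟩

/-- Two vertices with the same apex set have a common complementary vertex. -/
theorem map_eq_none_congr (hN : ∀ x y, N.Adj x y → ¬ N.Adj y x) {u v : ∀ i, Option (V i)}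
    (huv : ∀ i, u i = none ↔ v i = none) : f u = none ↔ f v = none := by
  obtain ⟨w, hw⟩ := exists_compl u
  rw [map_eq_none_iff_of_compl f hN hw,
    map_eq_none_iff_of_compl f hN fun i => (huv i).symm.trans (hw i)]

open Classical in
theorem exists_common_none (hN : ∀ x y, N.Adj x y → ¬ N.Adj y x)
    (hM : ∀ i, ∃ x y, (M i).Adj x y) {u v : ∀ i, Option (V i)} (hu : f u = none)
    (hv : f v = none) : ∃ i, u i = none ∧ v i = none := by
  by_contra! hc
  -- If the apex sets were disjoint, filling the other coordinates with tails and heads of arcs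
  -- would give an arc between two vertices sent to the apex, hence a loop there.
  choose x y hxy using hM
  have h1 : f (fun i => if u i = none then none else some (x i)) = none :=
    (map_eq_none_congr f hN fun i => by simp).1 hu
  have h2 : f (fun i => if v i = none then none else some (y i)) = none :=
    (map_eq_none_congr f hN fun i => by simp).1 hv
  have h3 := f.map_rel (a := fun i => if u i = none then none else some (x i))
    (b := fun i => if v i = none then none else some (y i)) fun i => by
      by_cases h : u i = none
      · simp [h, hc i h, cone]
      · by_cases h' : v i = none <;> simp [h, h', cone, hxy]
  rw [h1, h2] at h3
  exact h3

/-- Either the preimage of the apex is the set of the vertices with the apex in a fixed coordinate,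
or it has no vertex with the apex in at most one coordinate. -/
theorem preimage_apex_cases (hN : ∀ x y, N.Adj x y → ¬ N.Adj y x)
    (hM : ∀ i, ∃ x y, (M i).Adj x y) :
    (∃ i, ∀ u, f u = none ↔ u i = none) ∨
      ∀ u : ∀ i, Option (V i), (∀ i j, u i = none → u j = none → i = j) → f u ≠ none := by
  refine or_iff_not_imp_left.2 fun hc u hu hfu => hc ?_
  -- The apex set of `u` meets itself, so it is a singleton `{i}`, and every set of the family meets
  -- it. Conversely, if a set containing `i` were not in the family, its complement would be,
  -- without containing `i`.
  obtain ⟨i, hi, -⟩ := exists_common_none f hN hM hfu hfu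
  have key : ∀ v, f v = none → v i = none := by
    intro v hv
    obtain ⟨j, hj, hj'⟩ := exists_common_none f hN hM hfu hv
    rwa [hu i j hi hj]
  refine ⟨i, fun v => ⟨key v, fun hv => ?_⟩⟩
  by_contra hfv
  obtain ⟨w, hw⟩ := exists_compl v
  have h1 := map_eq_none_iff_of_compl f hN hw
  exact (hw i).1 hv (key w (by tauto))

open Classical in
/-- A homomorphism to a cone that sends to the apex exactly the vertices with the apex in the
coordinate `i` restricts to homomorphisms on copies of the `i`-th base, provided that the base is
bipartite. -/
theorem exists_restrict_of_apex (i : ι) (hf : ∀ u, f u = none ↔ u i = none) (c : V i → Bool)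
    (hc : ∀ x y, (M i).Adj x y → c x ≠ c y) (u : ∀ i, Option (V i)) (m : V i)
    (hu : u i = some m) :
    ∃ g : (M i).Adj →r N.Adj, f u = some (g m) := by
  obtain ⟨v, hv⟩ := exists_compl u
  -- Along an arc of `M i`, the coordinates other than `i` alternate between those of `u` and of a
  -- complementary `v`, which are linked in both directions; the 2-colouring `c` makes this
  -- consistent.
  let φ : V i → ∀ j, Option (V j) := fun x =>
    Function.update (if c x = c m then u else v) i (some x)
  have hφi : ∀ x, φ x i = some x := fun x => by simp [φ]
  have hφ : ∀ x y, (M i).Adj x y → (tensorProduct fun i => cone (M i)).Adj (φ x) (φ y) := by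
    intro x y hxy j
    by_cases hj : j = i
    · subst hj
      rw [hφi, hφi]
      exact hxy
    · have h1 := hc x y hxy
      have h2 : ∀ {u v : ∀ i, Option (V i)}, (∀ i, u i = none ↔ v i ≠ none) →
          (cone (M j)).Adj (u j) (v j) := fun h => tensorProduct_cone_adj_of_compl (M := M) h j
      simp only [φ, Function.update_of_ne hj]
      by_cases hx : c x = c m
      · rw [if_pos hx, if_neg (fun h => h1 (hx.trans h.symm))]
        exact h2 hv
      · have hy : c y = c m := by
          cases h3 : c x <;> cases h4 : c y <;> cases h5 : c m <;> simp_all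
        rw [if_neg hx, if_pos hy]
        exact h2 fun i => by have := hv i; tauto
  have hsome : ∀ x, ∃ y, f (φ x) = some y := fun x =>
    Option.ne_none_iff_exists'.1 fun h => by simpa [hφi] using (hf (φ x)).1 h
  choose g hg using hsome
  refine ⟨⟨g, fun {x y} hxy => ?_⟩, ?_⟩
  · have := f.map_rel (hφ x y hxy)
    rwa [hg, hg] at this
  · have hm : φ m = u := by
      simp only [φ, if_true, ← hu]
      exact Function.update_eq_self i u
    rw [← hm, hg]
    rfl

end ConeProduct

/-! ### Rigid digraphs are cores. -/

theorem isCore_of_forall_hom_eq_id {V : Type} [Finite V] (G : Digraph V)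
    (hG : ∀ f : G.Adj →r G.Adj, ∀ x, f x = x) : IsCore G := by
  refine ⟨inferInstance, ⟨⟨RelHom.id _⟩, ⟨RelHom.id _⟩⟩, fun X _ H ⟨⟨a⟩, ⟨b⟩⟩ => ?_⟩
  exact Nat.card_le_card_of_injective b
    (Function.LeftInverse.injective (g := a) fun x => hG (a.comp b) x)

theorem card_eq_of_isCoreOf {W V : Type} {C : Digraph W} {G : Digraph V} (hG : IsCore G)
    (hC : IsCoreOf C G) : Nat.card W = Nat.card V := by
  have := hC.1
  have := hG.1
  exact le_antisymm (hC.2.2 V G hG.2.1) (hG.2.2 W C hC.2.1)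

/-! ### Homomorphisms from the product to a factor are projections. -/

section Mountains

variable {h ℓ : ℕ} {S : Set (List ℕ)}

open Classical in
/-- The vertex all of whose coordinates lie on the last climb, at height `h - m - 1` for the
coordinates in `T` and `h - m` for the others. -/
def climbVertex (h : ℕ) (S : Set (List ℕ)) (m : ℕ) (T : Finset S) :
    ∀ d : S, Option (Fin ((mountainArcs h d.val).length + 1)) :=
  fun d => some ⟨(mountainArcs h d.val).length - (if d ∈ T then m + 1 else m), by omega⟩

/-- The conditions on `m` and `T` keep the tail of each arc on the last climb, which starts at
position `2 * d.val.sum + 1`. -/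
theorem climbVertex_adj (hh : 2 ≤ h) {m : ℕ} (hm : m + 2 ≤ h) (T : Finset S)
    (hT : T = ∅ ∨ m + 2 < h) :
    (coneProduct h S).Adj (climbVertex h S (m + 1) T) (climbVertex h S m T) := by
  intro d
  have := length_mountainArcs h d.val hh
  refine mountain_adj_last_climb hh _ _ ?_ ?_
  · dsimp only; split_ifs <;> omega
  · rcases hT with rfl | hT
    · simp; omega
    · dsimp only; split_ifs <;> omega

open Classical in
-- The vertices `climbVertex h S m ∅` form a walk whose image ends in a vertex as in
-- `directed_walk_end`. Lowering the coordinates of its endpoint one at a time does not change the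
-- image, yet lowering all of them gives an in-neighbour of the endpoint: the image would have a
-- loop, although it has no out-neighbour.
theorem not_hom_of_apex_not_mem [Finite S] (hh : 4 ≤ h) {l : List ℕ} (hne : l ≠ [])
    (hl : ∀ a ∈ l, 1 ≤ a ∧ a ≤ h - 2)
    (f : (coneProduct h S).Adj →r (cone (mountain h l)).Adj)
    (hf : ∀ u : ∀ d : S, Option (Fin ((mountainArcs h d.val).length + 1)),
      (∀ i j, u i = none → u j = none → i = j) → f u ≠ none) : False := by
  have hh' : 2 ≤ h := by omega
  have := Fintype.ofFinite S
  have hsome : ∀ m T, ∃ y, f (climbVertex h S m T) = some y := fun m T =>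
    Option.ne_none_iff_exists'.1 (hf _ fun i j hi => by simp [climbVertex] at hi)
  choose g hg using hsome
  have hg_adj : ∀ m, m + 2 ≤ h → (mountain h l).Adj (g (m + 1) ∅) (g m ∅) := by
    intro m hm
    have := f.map_rel (climbVertex_adj (S := S) hh' hm ∅ (.inl rfl))
    rwa [hg, hg] at this
  have hwalk := directed_walk_end hh hne hl (fun k => g (h - 1 - k) ∅) fun k hk => by
    have := hg_adj (h - 1 - (k + 1)) (by omega)
    rwa [show h - 1 - (k + 1) + 1 = h - 1 - k by omega] at this
  simp only [Nat.sub_self] at hwalk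
  have hconst : ∀ T : Finset S, g 0 T = g 0 ∅ := by
    intro T
    induction T using Finset.induction_on with
    | empty => rfl
    | insert i T hi ih =>
      -- An apex in coordinate `i` alone makes `b` an in-neighbour of the endpoint both before and
      -- after lowering that coordinate. The first image is the only out-neighbour of `f b`, so both
      -- images agree.
      let b : ∀ d : S, Option (Fin ((mountainArcs h d.val).length + 1)) :=
        fun d => if d = i then none else climbVertex h S 1 T d
      obtain ⟨y, hy⟩ : ∃ y, f b = some y := Option.ne_none_iff_exists'.1 <| hf b <| by
        intro d e hd he
        simp only [b, climbVertex, ite_eq_left_iff, reduceCtorEq, imp_false, not_not] at hd he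
        exact hd.trans he.symm
      have hb : ∀ T', (∀ d, d ≠ i → (d ∈ T' ↔ d ∈ T)) →
          (coneProduct h S).Adj b (climbVertex h S 0 T') := by
        intro T' hT' d
        by_cases hd : d = i
        · simp [b, hd, cone, climbVertex]
        · have := climbVertex_adj hh' (m := 0) (by omega) T (.inr (by omega)) d
          simpa [b, hd, climbVertex, hT' d hd] using this
      have h1 := f.map_rel (hb T fun _ _ => Iff.rfl)
      have h2 := f.map_rel (hb (insert i T) fun d hd => by simp [hd])
      rw [hg, hy] at h1 h2
      rw [ih] at h1
      exact hwalk.2 y _ h1 h2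
  have hlast : (coneProduct h S).Adj (climbVertex h S 0 Finset.univ) (climbVertex h S 0 ∅) := by
    have h1 : climbVertex h S 0 Finset.univ = climbVertex h S (0 + 1) ∅ := by
      funext d; simp [climbVertex]
    rw [h1]
    exact climbVertex_adj hh' (by omega) ∅ (.inl rfl)
  have := f.map_rel hlast
  rw [hg, hg, hconst] at this
  exact hwalk.1 _ this

theorem finite_DM (h ℓ : ℕ) : (DM h ℓ).Finite := by
  refine (List.finite_length_eq (Fin (h - 1)) ℓ |>.image (List.map Fin.val)).subset ?_
  rintro l ⟨h1, -, h3⟩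
  refine ⟨l.pmap (fun a ha => ⟨a, ha⟩) (fun a ha => by have := h3 a ha; omega), by simpa, ?_⟩
  simp [List.map_pmap]

theorem hom_eq_proj (hh : ℓ + 2 < h) (hS : S ⊆ DM h ℓ) (j : S)
    (f : (coneProduct h S).Adj →r (cone (mountain h j.val)).Adj)
    (u : ∀ d : S, Option (Fin ((mountainArcs h d.val).length + 1))) : f u = u j := by
  have hh' : 2 ≤ h := by omega
  have : Finite S := (finite_DM h ℓ).subset hS
  have hN : ∀ x y, (mountain h j.val).Adj x y → ¬ (mountain h j.val).Adj y x := by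
    intro x y hxy hyx
    have := (mountain_adj hh' hxy).1
    have := (mountain_adj hh' hyx).1
    omega
  have hM : ∀ i : S, ∃ x y, (mountain h i.val).Adj x y := fun i =>
    ⟨⟨0, by omega⟩, ⟨1, by simp [mountainArcs]⟩, mountain_adj_zero_one _ _ rfl rfl⟩
  obtain ⟨i, hi⟩ : ∃ i : S, ∀ u, f u = none ↔ u i = none := by
    refine (preimage_apex_cases f hN hM).resolve_right fun hc => ?_
    -- Without peaks the walk argument is unavailable, but `S` is then a singleton, so no vertex at
    -- all would go to the apex, against the complement rule.
    rcases Nat.eq_zero_or_pos ℓ with rfl | hℓ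
    · have hsub : ∀ d : S, d.val = [] := fun d => List.eq_nil_of_length_eq_zero (hS d.2).1
      have hall : ∀ d e : S, d = e := fun d e => Subtype.ext ((hsub d).trans (hsub e).symm)
      have h1 := hc (fun _ => none) fun d e _ _ => hall d e
      have h2 := hc (fun _ => some 0) fun d e _ _ => hall d e
      exact h1 ((map_eq_none_iff_of_compl f hN fun d => by simp).2 h2)
    · refine not_hom_of_apex_not_mem (by omega) ?_ (hS j.2).2.2 f hc
      rintro h0
      have := (hS j.2).1
      simp [h0] at this
      omega
  have hrestrict : ∀ u m, u i = some m →
      ∃ g : (mountain h i.val).Adj →r (mountain h j.val).Adj, f u = some (g m) :=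
    -- An oriented path is bipartite by the parity of the position.
    exists_restrict_of_apex f i hi (fun x => decide (x.val % 2 = 0)) fun x y hxy => by
      have := (mountain_adj hh' hxy).2
      simp only [ne_eq, decide_eq_decide]
      omega
  have hrigid := eq_of_hom_mountain hh' ((hS i.2).1.trans (hS j.2).1.symm)
    (fun a ha => ((hS i.2).2.2 a ha).1) (hS j.2).2.2
  obtain ⟨g, -⟩ := hrestrict (fun _ => some 0) 0 rfl
  obtain rfl : i = j := Subtype.ext (hrigid g).1
  cases hu : u i with
  | none => exact (hi u).2 hu
  | some m =>
    obtain ⟨g, hg⟩ := hrestrict u m hu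
    rw [hg, Fin.ext ((hrigid g).2 m)]

theorem isCore_coneProduct (hh : ℓ + 2 < h) (hS : S ⊆ DM h ℓ) : IsCore (coneProduct h S) := by
  have : Finite S := (finite_DM h ℓ).subset hS
  refine isCore_of_forall_hom_eq_id _ fun f u => funext fun j => ?_
  exact hom_eq_proj hh hS j ⟨fun u => f u j, fun {u v} huv => f.map_rel huv j⟩ u

theorem card_coneProduct (hh : 2 ≤ h) [Fintype S] :
    Nat.card (∀ d : S, Option (Fin ((mountainArcs h d.val).length + 1))) =
      ∏ d : S, (2 * d.val.sum + h + 2) := by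
  simp [length_mountainArcs h _ hh]

end Mountains

/-! ### Counting mountains and vertices. -/

theorem ncard_DM (h ℓ : ℕ) : (DM h ℓ).ncard = (h - 2).choose ℓ := by
  have himage : DM h ℓ =
      (fun s : Finset ℕ => s.sort (· ≥ ·)) '' (Finset.powersetCard ℓ (Finset.Icc 1 (h - 2))) := by
    ext l
    simp only [DM, Set.mem_ofPred_eq, Set.mem_image, Finset.mem_coe, Finset.mem_powersetCard]
    constructor
    · rintro ⟨h1, h2, h3⟩
      have hnodup : l.Nodup := h2.imp fun h => ne_of_gt h
      refine ⟨l.toFinset, ⟨fun a ha => ?_, ?_⟩, ?_⟩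
      · simpa using h3 a (by simpa using ha)
      · rw [List.toFinset_card_of_nodup hnodup, h1]
      · exact (List.toFinset_sort _ hnodup).2 (h2.imp fun h => le_of_lt h)
    · rintro ⟨s, ⟨h1, h2⟩, rfl⟩
      refine ⟨by simpa using h2, ?_, fun a ha => by simpa using h1 (by simpa using ha)⟩
      exact ((s.pairwise_sort (· ≥ ·)).and (s.sort_nodup (· ≥ ·))).imp fun ⟨h, h'⟩ =>
        lt_of_le_of_ne h (Ne.symm h')
  have hinj : Function.Injective fun s : Finset ℕ => s.sort (· ≥ ·) := fun s t hst => by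
    simpa using congrArg List.toFinset hst
  rw [himage, Set.ncard_image_of_injective _ hinj, Set.ncard_coe_finset, Finset.card_powersetCard,
    Nat.card_Icc, Nat.add_sub_cancel]

theorem DMtop_eq_image (h ℓ : ℕ) (hh : 3 ≤ h) (hℓ : 1 ≤ ℓ) :
    DMtop h ℓ = List.cons (h - 2) '' DM (h - 1) (ℓ - 1) := by
  ext l
  simp only [DMtop, DM, Set.mem_ofPred_eq, Set.mem_image]
  constructor
  · rintro ⟨⟨h1, h2, h3⟩, h4⟩
    obtain ⟨a, l, rfl⟩ : ∃ a l', l = a :: l' :=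
      List.exists_cons_of_ne_nil (by rintro rfl; simp at h4)
    obtain rfl : a = h - 2 := by simpa using h4
    rw [List.pairwise_cons] at h2
    refine ⟨l, ⟨by simp at h1; omega, h2.2, fun b hb => ?_⟩, rfl⟩
    have := h2.1 b hb
    have := h3 b (by simp [hb])
    omega
  · rintro ⟨l, ⟨h1, h2, h3⟩, rfl⟩
    refine ⟨⟨by simp; omega, List.pairwise_cons.2 ⟨fun b hb => ?_, h2⟩, fun b hb => ?_⟩, rfl⟩
    · have := h3 b hb; omega
    · rcases List.mem_cons.1 hb with rfl | hb
      · omega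
      · have := h3 b hb; omega

theorem ncard_DMtop (h ℓ : ℕ) (hh : 3 ≤ h) (hℓ : 1 ≤ ℓ) :
    (DMtop h ℓ).ncard = (h - 3).choose (ℓ - 1) := by
  rw [DMtop_eq_image h ℓ hh hℓ, Set.ncard_image_of_injective _ (List.cons_injective), ncard_DM]
  rfl

/-- The entries dominate `ℓ, …, 2, 1` termwise; the bound on the first entry carries the induction.
-/
theorem le_two_mul_sum {l : List ℕ} (hl : l.Pairwise (· > ·)) (hpos : ∀ a ∈ l, 1 ≤ a) :
    l.length * (l.length + 1) ≤ 2 * l.sum ∧ ∀ a ∈ l.head?, l.length ≤ a := by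
  induction l with
  | nil => simp
  | cons a l ih =>
    rw [List.pairwise_cons] at hl
    have h1 := ih hl.2 fun b hb => hpos b (by simp [hb])
    have h2 : l.length + 1 ≤ a := by
      cases l with
      | nil => simpa using hpos a (by simp)
      | cons b l =>
        have h3 := hl.1 b (by simp)
        have h4 := h1.2 b (by simp)
        omega
    refine ⟨?_, by simpa using h2⟩
    simp only [List.length_cons, List.sum_cons]
    nlinarith [h1.1]

/-- The sequence of the numbers `m - a`, for the entries `a` of `l`, in the reversed order. -/
def flipPeaks (m : ℕ) (l : List ℕ) : List ℕ :=
  (l.map (m - ·)).reverse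

theorem flipPeaks_mem {h ℓ : ℕ} {l : List ℕ} (hl : l ∈ DM h ℓ) : flipPeaks (h - 1) l ∈ DM h ℓ := by
  obtain ⟨h1, h2, h3⟩ := hl
  refine ⟨by simpa [flipPeaks] using h1, ?_, ?_⟩
  · rw [flipPeaks, List.pairwise_reverse, List.pairwise_map]
    refine h2.imp_of_mem fun {a b} ha hb hab => ?_
    have := h3 a ha
    omega
  · intro b hb
    simp only [flipPeaks, List.mem_reverse, List.mem_map] at hb
    obtain ⟨a, ha, rfl⟩ := hb
    have := h3 a ha
    omega

theorem flipPeaks_flipPeaks {m : ℕ} {l : List ℕ} (hl : ∀ a ∈ l, a ≤ m) :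
    flipPeaks m (flipPeaks m l) = l := by
  simp only [flipPeaks, List.map_reverse, List.reverse_reverse, List.map_map]
  refine (List.map_congr_left fun a ha => ?_).trans (List.map_id l)
  have := hl a ha
  simp; omega

theorem sum_flipPeaks {m : ℕ} {l : List ℕ} (hl : ∀ a ∈ l, a ≤ m) :
    (flipPeaks m l).sum + l.sum = l.length * m := by
  rw [flipPeaks, List.sum_reverse]
  induction l with
  | nil => simp
  | cons a l ih =>
    have h1 := hl a (by simp)
    have h2 := ih fun b hb => hl b (by simp [hb])
    simp only [List.map_cons, List.sum_cons, List.length_cons, Nat.add_mul]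
    omega

/-- Single factors may fall below the bound, so each sequence is paired with its image under `a ↦ 2k
+ 1 - a`. The two sums add up to `k (2k + 1)`, and the product of the two factors is at least the
square of the bound. -/
theorem pow_le_card_coneProduct_DM (k : ℕ) (hk : 1 ≤ k) :
    (k ^ 2 + 5 * k + 2) ^ ((2 * k).choose k) ≤
      Nat.card (∀ d : DM (2 * k + 2) k,
        Option (Fin ((mountainArcs (2 * k + 2) d.val).length + 1))) := by
  have : Fintype (DM (2 * k + 2) k) := (finite_DM _ _).fintype
  rw [card_coneProduct (by omega)]
  have hbound : ∀ d : DM (2 * k + 2) k, ∀ a ∈ d.val, a ≤ 2 * k + 2 - 1 := fun d a ha => by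
    have := (d.2.2.2 a ha).2; omega
  let σ : DM (2 * k + 2) k ≃ DM (2 * k + 2) k :=
    Function.Involutive.toPerm (fun d => ⟨flipPeaks (2 * k + 2 - 1) d.val, flipPeaks_mem d.2⟩)
      fun d => Subtype.ext (flipPeaks_flipPeaks (hbound d))
  have hcard : Fintype.card (DM (2 * k + 2) k) = (2 * k).choose k := by
    rw [← Nat.card_eq_fintype_card, Nat.card_coe_set_eq, ncard_DM]; rfl
  have hpair : ∀ d, (k ^ 2 + 5 * k + 2) ^ 2 ≤
      (2 * d.val.sum + (2 * k + 2) + 2) * (2 * (σ d).val.sum + (2 * k + 2) + 2) := by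
    intro d
    have h1 := (le_two_mul_sum d.2.2.1 fun a ha => (d.2.2.2 a ha).1).1
    have h2 := (le_two_mul_sum (σ d).2.2.1 fun a ha => ((σ d).2.2.2 a ha).1).1
    have h3 : (σ d).val.sum + d.val.sum = d.val.length * (2 * k + 1) := sum_flipPeaks (hbound d)
    rw [d.2.1] at h1 h3
    rw [(σ d).2.1] at h2
    generalize d.val.sum = s at *
    generalize (σ d).val.sum = t at *
    -- `x` and `y` are the excesses of `2s` and `2t` over the minimum `k (k + 1)`. With a fixed sum
    -- `2k²`, the product is smallest when one of them is 0.
    obtain ⟨x, hx⟩ := Nat.exists_eq_add_of_le h1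
    obtain ⟨y, hy⟩ := Nat.exists_eq_add_of_le h2
    have hxy : x + y = 2 * k ^ 2 := by nlinarith
    rw [hx, hy]
    calc (k ^ 2 + 5 * k + 2) ^ 2 ≤ (k ^ 2 + 3 * k + 4) * (k ^ 2 + 3 * k + 4 + 2 * k ^ 2) := by
          have h4 := Nat.le_self_pow (n := 2) (by norm_num) k
          have h5 : k ^ 2 ≤ k ^ 3 := Nat.pow_le_pow_right hk (by norm_num)
          have h6 : k ^ 3 ≤ k ^ 4 := Nat.pow_le_pow_right hk (by norm_num)
          ring_nf
          ring_nf at h4 h5 h6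
          nlinarith
      _ ≤ (k ^ 2 + 3 * k + 4) * (k ^ 2 + 3 * k + 4 + 2 * k ^ 2) + x * y := Nat.le_add_right _ _
      _ = _ := by rw [← hxy]; ring
  rw [← Nat.pow_le_pow_iff_left two_ne_zero]
  calc ((k ^ 2 + 5 * k + 2) ^ ((2 * k).choose k)) ^ 2
      = ∏ _d : DM (2 * k + 2) k, (k ^ 2 + 5 * k + 2) ^ 2 := by
        rw [Finset.prod_const, Finset.card_univ, hcard, ← pow_mul, ← pow_mul,
          Nat.mul_comm 2 (Nat.choose _ _)]
    _ ≤ ∏ d : DM (2 * k + 2) k,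
        (2 * d.val.sum + (2 * k + 2) + 2) * (2 * (σ d).val.sum + (2 * k + 2) + 2) :=
        Finset.prod_le_prod' fun d _ => hpair d
    _ = _ := by
        rw [Finset.prod_mul_distrib,
          Equiv.prod_comp σ fun d : DM (2 * k + 2) k => 2 * d.val.sum + (2 * k + 2) + 2, sq]

/-- No pairing is needed: the first entry is `2k` and the others sum to at least `k (k - 1) / 2`, so
every factor is at least `k² + 5k + 4`. -/
theorem pow_le_card_coneProduct_DMtop (k : ℕ) (hk : 1 ≤ k) :
    (k ^ 2 + 5 * k + 2) ^ ((2 * k - 1).choose (k - 1)) ≤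
      Nat.card (∀ d : DMtop (2 * k + 2) k,
        Option (Fin ((mountainArcs (2 * k + 2) d.val).length + 1))) := by
  have : Fintype (DMtop (2 * k + 2) k) := ((finite_DM _ _).subset fun _ h => h.1).fintype
  rw [card_coneProduct (by omega)]
  have hcard : Fintype.card (DMtop (2 * k + 2) k) = (2 * k - 1).choose (k - 1) := by
    rw [← Nat.card_eq_fintype_card, Nat.card_coe_set_eq, ncard_DMtop _ _ (by omega) hk]
    congr 1
  rw [← hcard, ← Finset.card_univ, ← Finset.prod_const]
  refine Finset.prod_le_prod' fun d _ => ?_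
  obtain ⟨l, hl, hdl⟩ : d.val ∈ List.cons _ '' DM _ _ :=
    (DMtop_eq_image (2 * k + 2) k (by omega) hk).subset d.2
  have h1 := (le_two_mul_sum hl.2.1 fun a ha => (hl.2.2 a ha).1).1
  rw [hl.1] at h1
  rw [← hdl, List.sum_cons]
  obtain ⟨m, rfl⟩ := Nat.exists_eq_add_of_le' hk
  simp only [Nat.add_sub_cancel] at h1 ⊢
  nlinarith

theorem mainTheorem1 :
    (∀ h ℓ : ℕ, ℓ + 2 < h →
      IsCore (coneProduct h (DM h ℓ)) ∧
      (DM h ℓ).ncard = (h - 2).choose ℓ ∧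
      (∀ d ∈ DM h ℓ, ∀ e ∈ DM h ℓ, d ≠ e →
        IsEmpty ((mountain h d).Adj ≃r (mountain h e).Adj))) ∧
    (∀ k : ℕ, 1 ≤ k → ∀ (W : Type) (C : Digraph W),
      IsCoreOf C (coneProduct (2 * k + 2) (DM (2 * k + 2) k)) →
        (k ^ 2 + 5 * k + 2) ^ ((2 * k).choose k) ≤ Nat.card W) ∧
    (∀ h ℓ : ℕ, 1 ≤ ℓ → ℓ + 2 < h →
      IsCore (coneProduct h (DMtop h ℓ)) ∧
      (DMtop h ℓ).ncard = (h - 3).choose (ℓ - 1)) ∧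
    (∀ k : ℕ, 1 ≤ k → ∀ (W : Type) (C : Digraph W),
      IsCoreOf C (coneProduct (2 * k + 2) (DMtop (2 * k + 2) k)) →
        (k ^ 2 + 5 * k + 2) ^ ((2 * k - 1).choose (k - 1)) ≤ Nat.card W) := by
  have htop : ∀ h ℓ, DMtop h ℓ ⊆ DM h ℓ := fun h ℓ d hd => hd.1
  refine ⟨fun h ℓ hh => ⟨isCore_coneProduct hh subset_rfl, ncard_DM h ℓ, ?_⟩, ?_, ?_, ?_⟩
  · intro d hd e he hde
    refine ⟨fun f => hde (eq_of_hom_mountain (by omega) (hd.1.trans he.1.symm)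
      (fun a ha => (hd.2.2 a ha).1) he.2.2 f.toRelEmbedding.toRelHom).1⟩
  · intro k hk W C hC
    rw [card_eq_of_isCoreOf (isCore_coneProduct (ℓ := k) (by omega) subset_rfl) hC]
    exact pow_le_card_coneProduct_DM k hk
  · exact fun h ℓ hℓ hh =>
      ⟨isCore_coneProduct hh (htop h ℓ), ncard_DMtop h ℓ (by omega) hℓ⟩
  · intro k hk W C hC
    rw [card_eq_of_isCoreOf (isCore_coneProduct (ℓ := k) (by omega) (htop _ _)) hC]
    exact pow_le_card_coneProduct_DMtop k hk
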